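/- Let $A_{F_4}$ be the Artin group of type $F_4$, that is, the group with generators $a_1,a_2,a_3,a_4$ and defining relations $$a_1a_3=a_3a_1,\quad a_1a_4=a_4a_1,\quad a_2a_4=a_4a_2,\quad a_1a_2a_1=a_2a_1a_2,\quad a_2a_3a_2a_3=a_3a_2a_3a_2,\quad a_3a_4a_3=a_4a_3a_4 .$$ Write $[x,y]=xyx^{-1}y^{-1}$, and let $A_{F_4}'$ be the commutator subgroup of $A_{F_4}$. For $k,\ell\in\mathbb Z$ put $$p_k=a_1^{k}a_2a_1^{-(k+1)},\qquad q_\ell=a_4^{\ell}a_3a_4^{-(\ell+1)} .$$ Then $p_k=[a_1^{k},a_2][a_1^{-1},a_2^{-1}]$ and $q_\ell=[a_4^{\ell},a_3][a_4^{-1},a_3^{-1}]$ for all $k,\ell\in\mathbb Z$. The group $A_{F_4}'$ is generated by the elements $p_k$ $(k\in\mathbb Z)$ and $q_\ell$ $(\ell\in\mathbb Z)$, and on these generators it has the defining relations $$p_k=p_{k+1}p_{k+2}^{-1}\ (k\in\mathbb Z),\qquad q_\ell=q_{\ell+1}q_{\ell+2}^{-1}\ (\ell\in\mathbb Z),\qquad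 p_kq_\ell p_{k+1}q_{\ell+1}=q_\ell p_kq_{\ell+1}p_{k+1}\ (k,\ell\in\mathbb Z).$$ Every $p_k$ lies in the subgroup generated by $p_0,p_1$, and every $q_\ell$ in the subgroup generated by $q_0,q_1$; hence $A_{F_4}'$ is finitely generated. Its abelianization $A_{F_4}'/A_{F_4}''$ is isomorphic to $\mathbb Z^4$, so $A_{F_4}'$ is not perfect. -/

import Mathlib

open scoped commutatorElement

/-- The alternating word `s t s t ⋯` with `m` letters, beginning with `s`, in the free group
on the letters. -/
def alternatingProd {S : Type*} (s t : S) : ℕ → FreeGroup S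
  | 0 => 1
  | m + 1 => FreeGroup.of s * alternatingProd t s m

/-- The relators of the Artin group of a Coxeter matrix `M`: one relation
`s t s ⋯ = t s t ⋯` (`M s t` letters on each side) for each pair `s ≠ t` with `M s t` finite.
(Mathlib encodes the Coxeter label `∞` as `0`.) -/
def artinRelators {S : Type*} (M : CoxeterMatrix S) : Set (FreeGroup S) :=
  {r | ∃ s t : S, s ≠ t ∧ M s t ≠ 0 ∧
    r = alternatingProd s t (M s t) * (alternatingProd t s (M s t))⁻¹}

/-- The Artin group of a Coxeter matrix. -/
abbrev ArtinGroup {S : Type*} (M : CoxeterMatrix S) : Type _ :=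
  PresentedGroup (artinRelators M)

/-- The Artin group of type `F₄`. -/
abbrev ArtinF4 : Type := ArtinGroup CoxeterMatrix.F₄

namespace ArtinF4

/-- The first standard generator. The generators `a₁, a₂, a₃, a₄` are numbered in the order in
which they appear along the Coxeter graph; the edge with label `4` joins `a₂` and `a₃`. -/
def a₁ : ArtinF4 := PresentedGroup.of 0

/-- The second standard generator. -/
def a₂ : ArtinF4 := PresentedGroup.of 1

/-- The third standard generator. -/
def a₃ : ArtinF4 := PresentedGroup.of 2

/-- The fourth standard generator. -/
def a₄ : ArtinF4 := PresentedGroup.of 3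

/-- `p k = a₁ ^ k * a₂ * a₁ ^ (-(k + 1))`. -/
def p (k : ℤ) : ArtinF4 := a₁ ^ k * a₂ * a₁ ^ (-(k + 1))

/-- `q l = a₄ ^ l * a₃ * a₄ ^ (-(l + 1))`. -/
def q (l : ℤ) : ArtinF4 := a₄ ^ l * a₃ * a₄ ^ (-(l + 1))

/-- The free generator that stands for `p k` in the presentation of the commutator subgroup. -/
def P (k : ℤ) : FreeGroup (ℤ ⊕ ℤ) := FreeGroup.of (Sum.inl k)

/-- The free generator that stands for `q l` in the presentation of the commutator subgroup. -/
def Q (l : ℤ) : FreeGroup (ℤ ⊕ ℤ) := FreeGroup.of (Sum.inr l)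

/-- The relators `u * v⁻¹` of the defining relations `u = v` of the commutator subgroup. -/
def commutatorRelators : Set (FreeGroup (ℤ ⊕ ℤ)) :=
  {r | ∃ k : ℤ, r = P k * (P (k + 1) * (P (k + 2))⁻¹)⁻¹} ∪
  {r | ∃ l : ℤ, r = Q l * (Q (l + 1) * (Q (l + 2))⁻¹)⁻¹} ∪
  {r | ∃ k l : ℤ, r = P k * Q l * P (k + 1) * Q (l + 1) *
    (Q l * P k * Q (l + 1) * P (k + 1))⁻¹}

end ArtinF4

/-!
Write `A` for the Artin group of type `F₄`. As `a₂ = p 0 * a₁` and `a₃ = q 0 * a₄`, the group `A`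
should be the semidirect product of the subgroup generated by the `p k` and `q l` with the free
abelian group on `a₁` and `a₄`, which acts by shifting the two indices (`ArtinF4.conj_p`,
`ArtinF4.conj_q`).

Let `K` be the abstract group on `P k`, `Q l` with the claimed relations (`ArtinF4.ShiftGroup`). The
`p k` and `q l` satisfy these relations: the first two come from the braid relations of
`a₁, a₂` and of `a₄, a₃`, and the third from the relation of `a₂` and `a₃`. This gives
a homomorphism `K → A`. The relations of `K` are invariant under shifts of either index, and `A` maps
to the holomorph `K ⋊ Aut K` by sending `a₁`, `a₄` to the two shifts and `a₂`, `a₃` to `P 0`, `Q 0`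
times a shift (`ArtinF4.toHolomorph`). The composite `K → A → K ⋊ Aut K` is the standard embedding,
so `K → A` is injective (`ArtinF4.ShiftGroup.toArtin_injective`). Working with the holomorph makes it
unnecessary to know that the two shifts generate a free abelian group. The image of `K` is normal
and, modulo it, `A` is generated by the commuting elements `a₁` and `a₄`, so it contains the
commutator subgroup; the other inclusion holds because the `p k` and `q l` are products of commutators
(`ArtinF4.closure_p_q`).

In the abelianization of `K` the third family of relations is void, and the first two are the linear
recurrence `x (k + 2) = x (k + 1) - x k`, whose solutions are determined by `x 0` and `x 1` through
an integer sequence of period `6` (`ArtinF4.coeff`). Hence the abelianization is free abelian on the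
classes of `P 0, P 1, Q 0, Q 1`.
-/

namespace ArtinF4

/-! ### Homomorphisms out of the two presented groups -/

section Presentations

variable {G : Type*} [Group G]

/-- Elements `x 0, x 1, x 2, x 3` of a group satisfying the six defining relations, as images of
`a₁, a₂, a₃, a₄`, determine a homomorphism from the Artin group of type `F₄`. -/
def lift (x : Fin 4 → G) (h₀₂ : x 0 * x 2 = x 2 * x 0) (h₀₃ : x 0 * x 3 = x 3 * x 0)
    (h₁₃ : x 1 * x 3 = x 3 * x 1) (h₀₁ : x 0 * x 1 * x 0 = x 1 * x 0 * x 1)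
    (h₁₂ : x 1 * x 2 * x 1 * x 2 = x 2 * x 1 * x 2 * x 1)
    (h₂₃ : x 2 * x 3 * x 2 = x 3 * x 2 * x 3) : ArtinF4 →* G :=
  PresentedGroup.toGroup (f := x) <| by
    rintro r ⟨s, t, hst, -, rfl⟩
    rw [map_mul, map_inv, mul_inv_eq_one]
    fin_cases s <;> fin_cases t <;>
      simp [CoxeterMatrix.F₄, alternatingProd, ← mul_assoc, h₀₂, h₀₃, h₁₃, h₀₁, h₁₂, h₂₃]
        at hst ⊢

theorem lift_of (x : Fin 4 → G) (h₀₂ h₀₃ h₁₃ h₀₁ h₁₂ h₂₃) (i : Fin 4) :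
    lift x h₀₂ h₀₃ h₁₃ h₀₁ h₁₂ h₂₃ (PresentedGroup.of i) = x i :=
  PresentedGroup.toGroup.of _

theorem artin_relation {s t : Fin 4} {m : ℕ} (hst : s ≠ t) (hm : m ≠ 0)
    (h : CoxeterMatrix.F₄ s t = m) :
    FreeGroup.lift (PresentedGroup.of : Fin 4 → ArtinF4) (alternatingProd s t m) =
      FreeGroup.lift PresentedGroup.of (alternatingProd t s m) := by
  subst h
  have h := PresentedGroup.mk_eq_mk_of_mul_inv_mem (rels := artinRelators CoxeterMatrix.F₄)
    ⟨s, t, hst, hm, rfl⟩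
  have e : FreeGroup.lift (PresentedGroup.of : Fin 4 → ArtinF4) = PresentedGroup.mk _ :=
    FreeGroup.ext_hom _ _ fun a => by rw [FreeGroup.lift_apply_of]; rfl
  rw [e, h]

theorem a₁_mul_a₃ : a₁ * a₃ = a₃ * a₁ := by
  simpa [alternatingProd, mul_assoc, a₁, a₂, a₃, a₄] using
    artin_relation (s := 0) (t := 2) (m := 2) (by decide) (by decide) rfl

theorem a₁_mul_a₄ : a₁ * a₄ = a₄ * a₁ := by
  simpa [alternatingProd, mul_assoc, a₁, a₂, a₃, a₄] using
    artin_relation (s := 0) (t := 3) (m := 2) (by decide) (by decide) rfl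

theorem a₂_mul_a₄ : a₂ * a₄ = a₄ * a₂ := by
  simpa [alternatingProd, mul_assoc, a₁, a₂, a₃, a₄] using
    artin_relation (s := 1) (t := 3) (m := 2) (by decide) (by decide) rfl

theorem a₁_braid_a₂ : a₁ * a₂ * a₁ = a₂ * a₁ * a₂ := by
  simpa [alternatingProd, mul_assoc, a₁, a₂, a₃, a₄] using
    artin_relation (s := 0) (t := 1) (m := 3) (by decide) (by decide) rfl

theorem a₂_braid_a₃ : a₂ * a₃ * a₂ * a₃ = a₃ * a₂ * a₃ * a₂ := by
  simpa [alternatingProd, mul_assoc, a₁, a₂, a₃, a₄] using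
    artin_relation (s := 1) (t := 2) (m := 4) (by decide) (by decide) rfl

theorem a₄_braid_a₃ : a₄ * a₃ * a₄ = a₃ * a₄ * a₃ := by
  simpa [alternatingProd, mul_assoc, a₁, a₂, a₃, a₄] using
    artin_relation (s := 3) (t := 2) (m := 3) (by decide) (by decide) rfl

/-- The abstract group with generators `P k`, `Q l` and the relations claimed for the commutator
subgroup. -/
abbrev ShiftGroup : Type := PresentedGroup commutatorRelators

namespace ShiftGroup

/-- The class of the free generator `P k`. -/
def P (k : ℤ) : ShiftGroup := PresentedGroup.of (Sum.inl k)

/-- The class of the free generator `Q l`. -/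
def Q (l : ℤ) : ShiftGroup := PresentedGroup.of (Sum.inr l)

theorem P_eq (k : ℤ) : P k = P (k + 1) * (P (k + 2))⁻¹ :=
  PresentedGroup.mk_eq_mk_of_mul_inv_mem (Or.inl (Or.inl ⟨k, rfl⟩))

theorem Q_eq (l : ℤ) : Q l = Q (l + 1) * (Q (l + 2))⁻¹ :=
  PresentedGroup.mk_eq_mk_of_mul_inv_mem (Or.inl (Or.inr ⟨l, rfl⟩))

theorem P_mul_Q (k l : ℤ) :
    P k * Q l * P (k + 1) * Q (l + 1) = Q l * P k * Q (l + 1) * P (k + 1) :=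
  PresentedGroup.mk_eq_mk_of_mul_inv_mem (Or.inr ⟨k, l, rfl⟩)

/-- Two bi-infinite sequences satisfying the relations of the `P k` and `Q l` determine a
homomorphism from `ShiftGroup`. -/
def lift (x y : ℤ → G) (hx : ∀ k, x k = x (k + 1) * (x (k + 2))⁻¹)
    (hy : ∀ l, y l = y (l + 1) * (y (l + 2))⁻¹)
    (hxy : ∀ k l, x k * y l * x (k + 1) * y (l + 1) = y l * x k * y (l + 1) * x (k + 1)) :
    ShiftGroup →* G :=
  PresentedGroup.toGroup (f := Sum.elim x y) <| by
    rintro r ((⟨k, rfl⟩ | ⟨l, rfl⟩) | ⟨k, l, rfl⟩) <;>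
      simp only [ArtinF4.P, ArtinF4.Q, map_mul, map_inv, FreeGroup.lift_apply_of, Sum.elim_inl,
        Sum.elim_inr] <;> rw [mul_inv_eq_one]
    exacts [hx k, hy l, hxy k l]

variable {x y : ℤ → G} {hx : ∀ k, x k = x (k + 1) * (x (k + 2))⁻¹}
  {hy : ∀ l, y l = y (l + 1) * (y (l + 2))⁻¹}
  {hxy : ∀ k l, x k * y l * x (k + 1) * y (l + 1) = y l * x k * y (l + 1) * x (k + 1)}

@[simp]
theorem lift_P (k : ℤ) : lift x y hx hy hxy (P k) = x k := PresentedGroup.toGroup.of _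

@[simp]
theorem lift_Q (l : ℤ) : lift x y hx hy hxy (Q l) = y l := PresentedGroup.toGroup.of _

theorem hom_ext {f g : ShiftGroup →* G} (hP : ∀ k, f (P k) = g (P k))
    (hQ : ∀ l, f (Q l) = g (Q l)) : f = g :=
  PresentedGroup.ext <| by rintro (k | l); exacts [hP k, hQ l]

/-- The endomorphism shifting the index of the `P k` by `m` and that of the `Q l` by `n`. -/
def shiftHom (m n : ℤ) : ShiftGroup →* ShiftGroup :=
  lift (fun k => P (k + m)) (fun l => Q (l + n))
    (fun k => by convert P_eq (k + m) using 3 <;> ring_nf)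
    (fun l => by convert Q_eq (l + n) using 3 <;> ring_nf)
    (fun k l => by
      simpa only [add_right_comm _ (1 : ℤ)] using P_mul_Q (k + m) (l + n))

@[simp]
theorem shiftHom_P (m n k : ℤ) : shiftHom m n (P k) = P (k + m) := lift_P ..

@[simp]
theorem shiftHom_Q (m n l : ℤ) : shiftHom m n (Q l) = Q (l + n) := lift_Q ..

/-- `shiftHom m n` as an automorphism. -/
def shift (m n : ℤ) : MulAut ShiftGroup :=
  (shiftHom m n).toMulEquiv (shiftHom (-m) (-n))
    (hom_ext (by simp) (by simp))
    (hom_ext (by simp) (by simp))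

@[simp]
theorem shift_P (m n k : ℤ) : shift m n (P k) = P (k + m) :=
  shiftHom_P m n k

@[simp]
theorem shift_Q (m n l : ℤ) : shift m n (Q l) = Q (l + n) :=
  shiftHom_Q m n l

theorem shift_mul (m n m' n' : ℤ) : shift m n * shift m' n' = shift (m + m') (n + n') :=
  MulEquiv.toMonoidHom_injective <| hom_ext
    (fun k => show shift m n (shift m' n' (P k)) = shift _ _ (P k) by simp; ring_nf)
    (fun l => show shift m n (shift m' n' (Q l)) = shift _ _ (Q l) by simp; ring_nf)

theorem shift_zero : shift 0 0 = 1 :=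
  MulEquiv.toMonoidHom_injective <| hom_ext
    (fun k => show shift 0 0 (P k) = P k by simp)
    (fun l => show shift 0 0 (Q l) = Q l by simp)

theorem shift_left_zpow (k : ℤ) : shift 1 0 ^ k = shift k 0 := by
  induction k with
  | zero => simp [shift_zero]
  | succ k ih => rw [zpow_add_one, ih, shift_mul]; simp
  | pred k ih =>
    rw [zpow_sub_one, ih, mul_inv_eq_iff_eq_mul, shift_mul]; simp

theorem shift_right_zpow (l : ℤ) : shift 0 1 ^ l = shift 0 l := by
  induction l with
  | zero => simp [shift_zero]
  | succ l ih => rw [zpow_add_one, ih, shift_mul]; simp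
  | pred l ih =>
    rw [zpow_sub_one, ih, mul_inv_eq_iff_eq_mul, shift_mul]; simp

end ShiftGroup

theorem next_of_recurrence {x : ℤ → G} (hx : ∀ k, x k = x (k + 1) * (x (k + 2))⁻¹) (k : ℤ) :
    x (k + 1 + 1) = (x k)⁻¹ * x (k + 1) := by
  rw [hx k, add_assoc k 1 1]; simp

theorem prev_of_recurrence {x : ℤ → G} (hx : ∀ k, x k = x (k + 1) * (x (k + 2))⁻¹) (k : ℤ) :
    x (k - 1) = x k * (x (k + 1))⁻¹ := by
  rw [hx (k - 1), sub_add_cancel, show k - 1 + 2 = k + 1 by ring]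

/-- A sequence with `x k = x (k + 1) * (x (k + 2))⁻¹` can be recovered, forwards and backwards,
from any two consecutive terms. -/
theorem mem_closure_pair_of_recurrence {x : ℤ → G}
    (hx : ∀ k, x k = x (k + 1) * (x (k + 2))⁻¹) (k : ℤ) :
    x k ∈ Subgroup.closure {x 0, x 1} := by
  suffices h : x k ∈ Subgroup.closure {x 0, x 1} ∧ x (k + 1) ∈ Subgroup.closure {x 0, x 1} from
    h.1
  induction k with
  | zero => exact ⟨Subgroup.subset_closure (by simp), Subgroup.subset_closure (by simp)⟩
  | succ k ih =>
    refine ⟨ih.2, ?_⟩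
    rw [next_of_recurrence hx]
    exact mul_mem (inv_mem ih.1) ih.2
  | pred k ih =>
    refine ⟨?_, by simpa using ih.1⟩
    rw [prev_of_recurrence hx]
    exact mul_mem ih.1 (inv_mem ih.2)

end Presentations

/-! ### The elements `p k` and `q l` of the Artin group -/

theorem eq_mul_commutators {G : Type*} [Group G] {x y : G} (h : x * y * x = y * x * y) (k : ℤ) :
    x ^ k * y * x ^ (-(k + 1)) = ⁅x ^ k, y⁆ * ⁅x⁻¹, y⁻¹⁆ := by
  have h' : y⁻¹ * x⁻¹ * y⁻¹ = x⁻¹ * y⁻¹ * x⁻¹ := by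
    simpa [mul_assoc] using (congrArg (·⁻¹) h).symm
  calc x ^ k * y * x ^ (-(k + 1)) = x ^ k * y * (x ^ k)⁻¹ * (x⁻¹ * y⁻¹ * x⁻¹) * x * y := by
        rw [neg_add, zpow_add, zpow_neg, zpow_neg_one]; group
    _ = _ := by rw [← h', commutatorElement_def, commutatorElement_def]; group

/-- The recurrence is the braid relation, multiplied by powers of `x`. For `x = a₁`, `y = a₂` it is
the recurrence of the `p k`, and for `x = a₄`, `y = a₃` that of the `q l`. -/
theorem recurrence_of_braid {G : Type*} [Group G] {x y : G} (h : x * y * x = y * x * y) (k : ℤ) :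
    x ^ k * y * x ^ (-(k + 1)) =
      x ^ (k + 1) * y * x ^ (-(k + 1 + 1)) * (x ^ (k + 2) * y * x ^ (-(k + 2 + 1)))⁻¹ := by
  have h' : y = x * y * x * y⁻¹ * x⁻¹ := by rw [h]; group
  calc x ^ k * y * x ^ (-(k + 1)) = x ^ k * (x * y * x * y⁻¹ * x⁻¹) * x ^ (-(k + 1)) := by
        rw [← h']
    _ = _ := by group

theorem p_eq (k : ℤ) : p k = p (k + 1) * (p (k + 2))⁻¹ := recurrence_of_braid a₁_braid_a₂ k

theorem q_eq (l : ℤ) : q l = q (l + 1) * (q (l + 2))⁻¹ := recurrence_of_braid a₄_braid_a₃ l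

/-- Conjugation by `a₁ ^ m * a₄ ^ n` acts on the `p k` and `q l` by shifting indices. -/
theorem conj_p (m n k : ℤ) : a₁ ^ m * a₄ ^ n * p k * (a₁ ^ m * a₄ ^ n)⁻¹ = p (k + m) := by
  have h₁₄ (k : ℤ) : Commute (a₄ ^ n) (a₁ ^ k) := (Commute.zpow_zpow a₁_mul_a₄ k n).symm
  have h : Commute (a₄ ^ n) (p k) :=
    ((h₁₄ k).mul_right (Commute.zpow_right a₂_mul_a₄ n).symm).mul_right (h₁₄ _)
  rw [mul_assoc _ _ (p k), h.eq, p, p]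
  group

theorem conj_q (m n l : ℤ) : a₁ ^ m * a₄ ^ n * q l * (a₁ ^ m * a₄ ^ n)⁻¹ = q (l + n) := by
  have h₁₄ (l : ℤ) : Commute (a₁ ^ m) (a₄ ^ l) := Commute.zpow_zpow a₁_mul_a₄ m l
  have h : Commute (a₁ ^ m) (q (l + n)) :=
    ((h₁₄ _).mul_right (Commute.zpow_left a₁_mul_a₃ m)).mul_right (h₁₄ _)
  rw [← mul_inv_eq_iff_eq_mul.mpr h.eq, q, q]
  group

theorem p_mul_q_zero : p 0 * q 0 * p 1 * q 1 = q 0 * p 0 * q 1 * p 1 := by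
  have h₁₃ : Commute a₁ a₃ := a₁_mul_a₃
  have h₁₄ : Commute a₁ a₄ := a₁_mul_a₄
  have h₂₄ : Commute a₂ a₄ := a₂_mul_a₄
  have hp : Commute (p 1) a₄ := by
    have := ((h₁₄.zpow_left 1).mul_left h₂₄).mul_left (h₁₄.zpow_left (-(1 + 1)))
    exact this
  have hq : Commute a₁ (q 1) := by
    have := ((h₁₄.zpow_right 1).mul_right h₁₃).mul_right (h₁₄.zpow_right (-(1 + 1)))
    exact this
  -- Both sides are `(a₂ a₃ a₂ a₃) a₁⁻² a₄⁻²`, up to the commutations above.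
  calc p 0 * q 0 * p 1 * q 1
      = a₂ * (a₁⁻¹ * a₃) * (a₄⁻¹ * p 1) * q 1 := by simp [p, q, mul_assoc]
    _ = a₂ * a₃ * a₁⁻¹ * p 1 * (a₄⁻¹ * q 1) := by
        rw [h₁₃.inv_left.eq, ← hp.inv_right.eq]; group
    _ = a₂ * a₃ * a₂ * (a₁ ^ (-2 : ℤ) * a₃) * a₄ ^ (-2 : ℤ) := by rw [p, q]; group
    _ = a₂ * a₃ * a₂ * a₃ * (a₁ ^ (-2 : ℤ) * a₄ ^ (-2 : ℤ)) := by
        rw [(h₁₃.zpow_left (-2)).eq]; group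
    _ = a₃ * a₂ * a₃ * (a₂ * a₄ ^ (-2 : ℤ)) * a₁ ^ (-2 : ℤ) := by
        rw [a₂_braid_a₃, (h₁₄.zpow_zpow (-2) (-2)).eq]; group
    _ = a₃ * a₂ * a₄⁻¹ * q 1 * (a₁⁻¹ * p 1) := by
        rw [(h₂₄.zpow_right (-2)).eq, p, q]; group
    _ = a₃ * (a₂ * a₄⁻¹) * (q 1 * a₁⁻¹) * p 1 := by group
    _ = q 0 * p 0 * q 1 * p 1 := by
        rw [h₂₄.inv_right.eq, ← hq.inv_left.eq]; simp [p, q, mul_assoc]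

/-- Conjugating the case `k = l = 0` by `a₁ ^ k * a₄ ^ l` gives the general case. -/
theorem p_mul_q (k l : ℤ) :
    p k * q l * p (k + 1) * q (l + 1) = q l * p k * q (l + 1) * p (k + 1) := by
  have h := congrArg (MulAut.conj (a₁ ^ k * a₄ ^ l)) p_mul_q_zero
  rw [map_mul, map_mul, map_mul, map_mul _ _ (p 1), map_mul _ _ (q 1), map_mul _ (q 0) (p 0)] at h
  simpa only [MulAut.conj_apply, conj_p, conj_q, zero_add, add_comm (1 : ℤ)] using h

theorem p_zero_mul : p 0 * a₁ = a₂ := by simp [p]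

theorem q_zero_mul : q 0 * a₄ = a₃ := by simp [q]

/-! ### The presentation of the commutator subgroup -/

/-- The homomorphism sending the abstract generators to the elements `p k` and `q l`. -/
def ShiftGroup.toArtin : ShiftGroup →* ArtinF4 := ShiftGroup.lift p q p_eq q_eq p_mul_q

theorem ShiftGroup.toArtin_P (k : ℤ) : toArtin (P k) = p k := lift_P ..

theorem ShiftGroup.toArtin_Q (l : ℤ) : toArtin (Q l) = q l := lift_Q ..

/-- The homomorphism from the Artin group to the holomorph of `ShiftGroup` sending `a₁` and `a₄` to
the shifts of the `P k` and of the `Q l`, and `a₂ = p 0 * a₁`, `a₃ = q 0 * a₄` accordingly. -/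
def toHolomorph : ArtinF4 →* ShiftGroup ⋊[MonoidHom.id _] MulAut ShiftGroup :=
  lift ![⟨1, ShiftGroup.shift 1 0⟩, ⟨ShiftGroup.P 0, ShiftGroup.shift 1 0⟩,
      ⟨ShiftGroup.Q 0, ShiftGroup.shift 0 1⟩, ⟨1, ShiftGroup.shift 0 1⟩]
    (by ext1 <;> simp [ShiftGroup.shift_mul])
    (by ext1 <;> simp [ShiftGroup.shift_mul])
    (by ext1 <;> simp [ShiftGroup.shift_mul])
    (by
      ext1
      · simpa [ShiftGroup.shift_mul] using (eq_mul_inv_iff_mul_eq.mp (ShiftGroup.P_eq 0)).symm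
      · simp [ShiftGroup.shift_mul])
    (by
      ext1
      · simpa [ShiftGroup.shift_mul] using ShiftGroup.P_mul_Q 0 0
      · simp [ShiftGroup.shift_mul])
    (by
      ext1
      · simpa [ShiftGroup.shift_mul] using eq_mul_inv_iff_mul_eq.mp (ShiftGroup.Q_eq 0)
      · simp [ShiftGroup.shift_mul])

theorem toHolomorph_a₁ : toHolomorph a₁ = SemidirectProduct.inr (ShiftGroup.shift 1 0) :=
  lift_of ..

theorem toHolomorph_a₂ :
    toHolomorph a₂ =
      SemidirectProduct.inl (ShiftGroup.P 0) * SemidirectProduct.inr (ShiftGroup.shift 1 0) :=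
  (lift_of ..).trans (SemidirectProduct.mk_eq_inl_mul_inr ..)

theorem toHolomorph_a₃ :
    toHolomorph a₃ =
      SemidirectProduct.inl (ShiftGroup.Q 0) * SemidirectProduct.inr (ShiftGroup.shift 0 1) :=
  (lift_of ..).trans (SemidirectProduct.mk_eq_inl_mul_inr ..)

theorem toHolomorph_a₄ : toHolomorph a₄ = SemidirectProduct.inr (ShiftGroup.shift 0 1) :=
  lift_of ..

theorem toHolomorph_p_zero : toHolomorph (p 0) = SemidirectProduct.inl (ShiftGroup.P 0) := by
  rw [eq_mul_inv_of_mul_eq p_zero_mul, map_mul, map_inv, toHolomorph_a₂, toHolomorph_a₁,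
    mul_inv_cancel_right]

theorem toHolomorph_q_zero : toHolomorph (q 0) = SemidirectProduct.inl (ShiftGroup.Q 0) := by
  rw [eq_mul_inv_of_mul_eq q_zero_mul, map_mul, map_inv, toHolomorph_a₃, toHolomorph_a₄,
    mul_inv_cancel_right]

theorem toHolomorph_p (k : ℤ) : toHolomorph (p k) = SemidirectProduct.inl (ShiftGroup.P k) := by
  have h := conj_p k 0 0
  rw [zpow_zero, mul_one, zero_add] at h
  rw [← h, map_mul, map_mul, map_inv, map_zpow, toHolomorph_a₁, toHolomorph_p_zero, ← map_zpow,
    ShiftGroup.shift_left_zpow, ← map_inv, ← SemidirectProduct.inl_aut]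
  simp

theorem toHolomorph_q (l : ℤ) : toHolomorph (q l) = SemidirectProduct.inl (ShiftGroup.Q l) := by
  have h := conj_q 0 l 0
  rw [zpow_zero, one_mul, zero_add] at h
  rw [← h, map_mul, map_mul, map_inv, map_zpow, toHolomorph_a₄, toHolomorph_q_zero, ← map_zpow,
    ShiftGroup.shift_right_zpow, ← map_inv, ← SemidirectProduct.inl_aut]
  simp

/-- Following `toArtin` by `toHolomorph` gives the embedding of `ShiftGroup` in its holomorph, so the
relations among the `p k` and `q l` all follow from those of `ShiftGroup`. -/
theorem ShiftGroup.toArtin_injective : Function.Injective ShiftGroup.toArtin := by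
  have h : toHolomorph.comp toArtin = SemidirectProduct.inl :=
    hom_ext (fun k => by simp [toArtin_P, toHolomorph_p])
      (fun l => by simp [toArtin_Q, toHolomorph_q])
  refine Function.Injective.of_comp (f := toHolomorph) ?_
  rw [← MonoidHom.coe_comp, h]
  exact SemidirectProduct.inl_injective

theorem ShiftGroup.range_toArtin :
    toArtin.range = Subgroup.closure (Set.range p ∪ Set.range q) := by
  rw [MonoidHom.range_eq_map, ← PresentedGroup.closure_range_of, MonoidHom.map_closure,
    ← Set.range_comp]
  congr 1
  ext g
  simp only [Set.mem_range, Sum.exists, Set.mem_union]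
  exact or_congr (exists_congr fun k => by rw [← toArtin_P]; rfl)
    (exists_congr fun k => by rw [← toArtin_Q]; rfl)

theorem p_eq_mul_commutators (k : ℤ) : p k = ⁅a₁ ^ k, a₂⁆ * ⁅a₁⁻¹, a₂⁻¹⁆ :=
  eq_mul_commutators a₁_braid_a₂ k

theorem q_eq_mul_commutators (l : ℤ) : q l = ⁅a₄ ^ l, a₃⁆ * ⁅a₄⁻¹, a₃⁻¹⁆ :=
  eq_mul_commutators a₄_braid_a₃ l

theorem closure_a : Subgroup.closure {a₁, a₂, a₃, a₄} = (⊤ : Subgroup ArtinF4) := by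
  rw [← PresentedGroup.closure_range_of]
  congr 1
  ext g
  simp [Fin.exists_fin_succ, a₁, a₂, a₃, a₄, eq_comm]

theorem normal_closure_p_q : (Subgroup.closure (Set.range p ∪ Set.range q)).Normal := by
  set H := Subgroup.closure (Set.range p ∪ Set.range q) with hH
  have hp (k : ℤ) : p k ∈ H := Subgroup.subset_closure (Or.inl ⟨k, rfl⟩)
  have hq (l : ℤ) : q l ∈ H := Subgroup.subset_closure (Or.inr ⟨l, rfl⟩)
  -- Conjugation by `a₁ ^ m * a₄ ^ n` permutes the generators of `H`.
  have key (m n : ℤ) : a₁ ^ m * a₄ ^ n ∈ Subgroup.normalizer (H : Set ArtinF4) := by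
    have h₁ : MulAut.conj (a₁ ^ m * a₄ ^ n) ∘ p = p ∘ Equiv.addRight m :=
      funext fun k => conj_p m n k
    have h₂ : MulAut.conj (a₁ ^ m * a₄ ^ n) ∘ q = q ∘ Equiv.addRight n :=
      funext fun l => conj_q m n l
    rw [Subgroup.mem_normalizer_iff_map_conj_eq, hH, MonoidHom.map_closure, MonoidHom.coe_coe,
      Set.image_union, ← Set.range_comp, ← Set.range_comp, h₁, h₂,
      (Equiv.addRight m).surjective.range_comp, (Equiv.addRight n).surjective.range_comp]
  have h₁ : a₁ ∈ Subgroup.normalizer (H : Set ArtinF4) := by simpa using key 1 0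
  have h₄ : a₄ ∈ Subgroup.normalizer (H : Set ArtinF4) := by simpa using key 0 1
  rw [← Subgroup.normalizer_eq_top_iff, eq_top_iff, ← closure_a, Subgroup.closure_le]
  rintro _ (rfl | rfl | rfl | rfl)
  · exact h₁
  · rw [← p_zero_mul]; exact mul_mem (Subgroup.le_normalizer (hp 0)) h₁
  · rw [← q_zero_mul]; exact mul_mem (Subgroup.le_normalizer (hq 0)) h₄
  · exact h₄

/-- Each `p k` and `q l` is a product of commutators. Conversely, they generate a normal subgroup,
and modulo it the Artin group is generated by the commuting elements `a₁` and `a₄`. -/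
theorem closure_p_q : Subgroup.closure (Set.range p ∪ Set.range q) = commutator ArtinF4 := by
  apply le_antisymm
  · rw [Subgroup.closure_le, commutator_def]
    have h (x y : ArtinF4) : ⁅x, y⁆ ∈ ⁅(⊤ : Subgroup ArtinF4), (⊤ : Subgroup ArtinF4)⁆ :=
      Subgroup.commutator_mem_commutator trivial trivial
    rintro _ (⟨k, rfl⟩ | ⟨l, rfl⟩)
    · rw [p_eq_mul_commutators]; exact mul_mem (h _ _) (h _ _)
    · rw [q_eq_mul_commutators]; exact mul_mem (h _ _) (h _ _)
  · -- The commutative subgroup `⟨a₁, a₄⟩` supplements the subgroup generated by the `p k`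
    -- and `q l`.
    have := normal_closure_p_q
    refine Subgroup.Normal.commutator_le_of_self_sup_commutative_eq_top
      (H := Subgroup.closure {a₁, a₄}) ?_ ?_
    · rw [eq_top_iff, ← closure_a, Subgroup.closure_le]
      have h₁ : a₁ ∈ Subgroup.closure (Set.range p ∪ Set.range q) ⊔ Subgroup.closure {a₁, a₄} :=
        Subgroup.mem_sup_right (Subgroup.subset_closure (by simp))
      have h₄ : a₄ ∈ Subgroup.closure (Set.range p ∪ Set.range q) ⊔ Subgroup.closure {a₁, a₄} :=
        Subgroup.mem_sup_right (Subgroup.subset_closure (by simp))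
      rintro _ (rfl | rfl | rfl | rfl)
      · exact h₁
      · rw [← p_zero_mul]
        exact mul_mem (Subgroup.mem_sup_left (Subgroup.subset_closure (Or.inl ⟨0, rfl⟩))) h₁
      · rw [← q_zero_mul]
        exact mul_mem (Subgroup.mem_sup_left (Subgroup.subset_closure (Or.inr ⟨0, rfl⟩))) h₄
      · exact h₄
    · refine Subgroup.isMulCommutative_closure ?_
      rintro _ (rfl | rfl) _ (rfl | rfl)
      exacts [rfl, a₁_mul_a₄, a₁_mul_a₄.symm, rfl]

/-- The isomorphism from the abstract group to the commutator subgroup induced by `toArtin`. -/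
noncomputable def ShiftGroup.equivCommutator : ShiftGroup ≃* commutator ArtinF4 :=
  (MonoidHom.ofInjective toArtin_injective).trans
    (MulEquiv.subgroupCongr (range_toArtin.trans closure_p_q))

theorem fg_commutator : Group.FG (commutator ArtinF4) := by
  rw [Group.fg_iff_subgroup_fg, Subgroup.fg_iff]
  refine ⟨{p 0, p 1} ∪ {q 0, q 1}, ?_, by simp⟩
  rw [← closure_p_q]
  apply le_antisymm
  · apply Subgroup.closure_mono
    rintro _ ((rfl | rfl) | (rfl | rfl))
    exacts [Or.inl ⟨0, rfl⟩, Or.inl ⟨1, rfl⟩, Or.inr ⟨0, rfl⟩, Or.inr ⟨1, rfl⟩]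
  · rw [Subgroup.closure_le]
    rintro _ (⟨k, rfl⟩ | ⟨l, rfl⟩)
    · exact Subgroup.closure_mono Set.subset_union_left (mem_closure_pair_of_recurrence p_eq k)
    · exact Subgroup.closure_mono Set.subset_union_right (mem_closure_pair_of_recurrence q_eq l)

/-! ### The abelianization -/

/-- The solution of `c (k + 2) = c (k + 1) - c k` with `c 0 = 1` and `c 1 = 0`; it has
period `6`. -/
def coeff (k : ℤ) : ℤ :=
  if k % 6 = 0 ∨ k % 6 = 5 then 1 else if k % 6 = 2 ∨ k % 6 = 3 then -1 else 0

theorem coeff_zero : coeff 0 = 1 := rfl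

theorem coeff_one : coeff 1 = 0 := rfl

theorem coeff_two : coeff 2 = -1 := rfl

theorem coeff_add_two (k : ℤ) : coeff (k + 2) = coeff (k + 1) - coeff k := by
  unfold coeff
  split_ifs <;> omega

/-- In a commutative group the recurrence of the `p k` and `q l` is solved by `coeff`. -/
theorem eq_zpow_mul_zpow_of_recurrence {B : Type*} [CommGroup B] {x : ℤ → B}
    (hx : ∀ k, x k = x (k + 1) * (x (k + 2))⁻¹) (k : ℤ) :
    x k = x 0 ^ coeff k * x 1 ^ (-coeff (k + 1)) := by
  suffices h : x k = x 0 ^ coeff k * x 1 ^ (-coeff (k + 1)) ∧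
      x (k + 1) = x 0 ^ coeff (k + 1) * x 1 ^ (-coeff (k + 1 + 1)) from h.1
  -- `module` proves the inductive steps in the additive group.
  induction k with
  | zero => simp [coeff]
  | succ k ih =>
    have h₁ : coeff (k + 1 + 1) = coeff (k + 1) - coeff k := by
      rw [← coeff_add_two, add_assoc]; rfl
    have h₂ : coeff (k + 1 + 1 + 1) = coeff (k + 1 + 1) - coeff (k + 1) := by
      rw [← coeff_add_two (k + 1)]; rfl
    refine ⟨ih.2, ?_⟩
    rw [next_of_recurrence hx, ih.2, ih.1, h₂, h₁]
    apply Additive.ofMul.injective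
    simp only [ofMul_mul, ofMul_inv, ofMul_zpow]
    module
  | pred k ih =>
    have h₁ : coeff (-k - 1) = coeff (-k) - coeff (-k + 1) := by
      have := coeff_add_two (-k - 1)
      rw [sub_add_cancel, show -(k : ℤ) - 1 + 2 = -k + 1 by ring] at this
      omega
    have h₂ : coeff (-k + 1 + 1) = coeff (-k + 1) - coeff (-k) := by
      rw [← coeff_add_two, add_assoc]; rfl
    rw [sub_add_cancel]
    refine ⟨?_, ih.1⟩
    rw [prev_of_recurrence hx, ih.2, ih.1, h₂, h₁]
    apply Additive.ofMul.injective
    simp only [ofMul_mul, ofMul_inv, ofMul_zpow]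
    module

namespace ShiftGroup

/-- The homomorphism to `ℤ⁴` sending `P 0, P 1, Q 0, Q 1` to the standard basis. -/
def toInt : ShiftGroup →* Multiplicative (Fin 4 → ℤ) :=
  lift (fun k => .ofAdd ![coeff k, -coeff (k + 1), 0, 0])
    (fun l => .ofAdd ![0, 0, coeff l, -coeff (l + 1)])
    (fun k => by
      rw [← ofAdd_neg, ← ofAdd_add]
      congr 1
      ext i
      have h₁ := coeff_add_two k
      have h₂ := coeff_add_two (k + 1)
      fin_cases i <;> simp <;> grind)
    (fun l => by
      rw [← ofAdd_neg, ← ofAdd_add]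
      congr 1
      ext i
      have h₁ := coeff_add_two l
      have h₂ := coeff_add_two (l + 1)
      fin_cases i <;> simp <;> grind)
    (fun k l => by simp only [mul_comm, mul_left_comm])

/-- The homomorphism from `ℤ⁴` to the abelianization sending the standard basis to the classes of
`P 0, P 1, Q 0, Q 1`. -/
def ofInt : Multiplicative (Fin 4 → ℤ) →* Abelianization ShiftGroup where
  toFun v := .of (P 0) ^ v.toAdd 0 * .of (P 1) ^ v.toAdd 1 * .of (Q 0) ^ v.toAdd 2 *
    .of (Q 1) ^ v.toAdd 3
  map_one' := by simp
  map_mul' v w := by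
    simp only [toAdd_mul, Pi.add_apply, zpow_add]
    ac_rfl

/-- The abelianization is free abelian on the classes of `P 0, P 1, Q 0, Q 1`. -/
def abelianizationEquiv : Abelianization ShiftGroup ≃* Multiplicative (Fin 4 → ℤ) :=
  (Abelianization.lift toInt).toMulEquiv ofInt
    (Abelianization.hom_ext _ _ <| hom_ext
      (fun k => by
        have h := eq_zpow_mul_zpow_of_recurrence (x := fun k => Abelianization.of (P k))
          (fun k => by rw [← map_inv, ← map_mul, ← P_eq]) k
        simp [ofInt, toInt, h, coeff_zero, coeff_one, coeff_two])
      (fun l => by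
        have h := eq_zpow_mul_zpow_of_recurrence (x := fun l => Abelianization.of (Q l))
          (fun l => by rw [← map_inv, ← map_mul, ← Q_eq]) l
        simp [ofInt, toInt, h, coeff_zero, coeff_one, coeff_two]))
    (by
      ext v i
      fin_cases i <;> simp [ofInt, toInt, coeff_zero, coeff_one, coeff_two])

end ShiftGroup

end ArtinF4

theorem mainTheorem10 :
    -- the elements `p k`, `q l` as products of two commutators
    (∀ k : ℤ, ArtinF4.p k =
      ⁅ArtinF4.a₁ ^ k, ArtinF4.a₂⁆ * ⁅ArtinF4.a₁⁻¹, ArtinF4.a₂⁻¹⁆) ∧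
    (∀ l : ℤ, ArtinF4.q l =
      ⁅ArtinF4.a₄ ^ l, ArtinF4.a₃⁆ * ⁅ArtinF4.a₄⁻¹, ArtinF4.a₃⁻¹⁆) ∧
    -- they generate the commutator subgroup
    Subgroup.closure (Set.range ArtinF4.p ∪ Set.range ArtinF4.q) = commutator ArtinF4 ∧
    -- with the stated defining relations
    (∃ e : PresentedGroup ArtinF4.commutatorRelators ≃* commutator ArtinF4,
      (∀ k : ℤ, (e (PresentedGroup.of (Sum.inl k)) : ArtinF4) = ArtinF4.p k) ∧
      (∀ l : ℤ, (e (PresentedGroup.of (Sum.inr l)) : ArtinF4) = ArtinF4.q l)) ∧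
    -- all generators are expressible in four of them, and the group is finitely generated
    (∀ k : ℤ, ArtinF4.p k ∈ Subgroup.closure {ArtinF4.p 0, ArtinF4.p 1}) ∧
    (∀ l : ℤ, ArtinF4.q l ∈ Subgroup.closure {ArtinF4.q 0, ArtinF4.q 1}) ∧
    Group.FG (commutator ArtinF4) ∧
    -- its abelianization is free abelian of rank four, and it is not perfect
    Nonempty (Abelianization (commutator ArtinF4) ≃* Multiplicative (Fin 4 → ℤ)) ∧
    ¬ Group.IsPerfect (commutator ArtinF4) := by
  have hab : Abelianization (commutator ArtinF4) ≃* Multiplicative (Fin 4 → ℤ) :=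
    ArtinF4.ShiftGroup.equivCommutator.symm.abelianizationCongr.trans
      ArtinF4.ShiftGroup.abelianizationEquiv
  refine ⟨ArtinF4.p_eq_mul_commutators, ArtinF4.q_eq_mul_commutators, ArtinF4.closure_p_q,
    ⟨ArtinF4.ShiftGroup.equivCommutator, ArtinF4.ShiftGroup.toArtin_P,
      ArtinF4.ShiftGroup.toArtin_Q⟩,
    ArtinF4.mem_closure_pair_of_recurrence ArtinF4.p_eq,
    ArtinF4.mem_closure_pair_of_recurrence ArtinF4.q_eq, ArtinF4.fg_commutator, ⟨hab⟩, ?_⟩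
  rw [Group.isPerfect_def]
  intro h
  have : Subsingleton (Abelianization (commutator ArtinF4)) := by
    rw [Abelianization, h]
    exact QuotientGroup.subsingleton_quotient_top
  exact not_subsingleton _ hab.symm.toEquiv.subsingleton
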